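/- A *direct tract* of a complex valued function $f$ is an unbounded domain $D\subset\mathbb C$ with unbounded complement, whose boundary consists of piecewise smooth curves, such that $f$ is defined on a set containing $\overline D$, is holomorphic in $D$ and continuous on $\overline D$, and for some $R>0$ satisfies $|f(z)|=R$ for $z\in\partial D$ and $|f(z)|>R$ for $z\in D$. It is a *logarithmic tract* of $f$ if, in addition, the restriction $f:D\to\{w\in\mathbb C:|w|>R\}$ is a universal covering. Write $$M_D(\rho)=\max_{|z|=\rho,\ z\in D}|f(z)|,\qquad A(r,s)=\{z:r<|z|<s\},\qquad \overline A(r,s)=\{z:r\le|z|\le s\}.$$ **Lemma.** Let $D$ be a logarithmic tract of $f$ such that $f(D)=\{w\in\mathbb C:|w|>1\}$, where $f$ is also defined at $0$ and $|f(0)|<1$. Let $c>1$ and let $r_0>0$ be such that $D$ meets the circle $\{|z|=r_0\}$ and $$M_D(r_0)>\exp\left(\frac{8\pi^2c}{c-1}\right).$$ If $\Sigma=A(r_0,cr_0)\cap D$, then $$f(\Sigma)\supset\overline A\left(\exp\left(\frac{8\pi^2c}{c-1}\right),\,M_D(r_0)\right).$$ -/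

import Mathlib

/-- A piecewise smooth curve in the plane: the image of a nondegenerate interval `I` (of any kind,
so that closed curves and curves tending to infinity are included) under a continuous map which,
away from a locally finite set `P` of parameters, is continuously differentiable with nonvanishing
derivative, up to and including the (one-sided) derivatives at the break points. -/
def IsPiecewiseSmoothCurve (C : Set ℂ) : Prop :=
  ∃ (γ : ℝ → ℂ) (I P : Set ℝ),
    I.OrdConnected ∧ I.Nontrivial ∧ ContinuousOn γ I ∧ C = γ '' I ∧
    (∀ a b : ℝ, (P ∩ Set.Icc a b).Finite) ∧
    ∀ a b : ℝ, a < b → Set.Icc a b ⊆ I → Disjoint (Set.Ioo a b) P →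
      ContDiffOn ℝ 1 γ (Set.Icc a b) ∧
        ∀ t ∈ Set.Icc a b, derivWithin γ (Set.Icc a b) t ≠ 0

/-- `p` is a universal covering: a surjective covering map with simply connected total space. -/
def IsUniversalCovering {X Y : Type*} [TopologicalSpace X] [TopologicalSpace Y]
    (p : X → Y) : Prop :=
  SimplyConnectedSpace X ∧ IsCoveringMap p ∧ Function.Surjective p

/-- `D` is a direct tract of `f` with boundary modulus `R`. The values of `f` off the closure of
`D` play no role, so `f` may be thought of as an arbitrary function whose domain of definition
contains the closure of `D`. -/
structure IsDirectTractWith (f : ℂ → ℂ) (D : Set ℂ) (R : ℝ) : Prop where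
  isOpen : IsOpen D
  isConnected : IsConnected D
  unbounded : ¬ Bornology.IsBounded D
  unbounded_compl : ¬ Bornology.IsBounded Dᶜ
  boundary : ∃ 𝒞 : Set (Set ℂ), (∀ C ∈ 𝒞, IsPiecewiseSmoothCurve C) ∧ frontier D = ⋃₀ 𝒞
  differentiableOn : DifferentiableOn ℂ f D
  continuousOn : ContinuousOn f (closure D)
  pos : 0 < R
  norm_eq : ∀ z ∈ frontier D, ‖f z‖ = R
  lt_norm : ∀ z ∈ D, R < ‖f z‖

/-- `D` is a direct tract of `f`. -/
def IsDirectTract (f : ℂ → ℂ) (D : Set ℂ) : Prop :=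
  ∃ R : ℝ, IsDirectTractWith f D R

/-- `D` is a logarithmic tract of `f`: a direct tract, with boundary modulus `R`, for which the
restriction `f : D → {w | R < |w|}` is a universal covering. -/
def IsLogarithmicTract (f : ℂ → ℂ) (D : Set ℂ) : Prop :=
  ∃ (R : ℝ) (h : IsDirectTractWith f D R),
    IsUniversalCovering (Set.MapsTo.restrict f D {w : ℂ | R < ‖w‖} h.lt_norm)

/-- `M_D(ρ)`, the maximum of `|f(z)|` over `z ∈ D` with `|z| = ρ`. For a direct tract this supremum
is attained as soon as `D` meets the circle, because `f` is continuous on the closure of `D` and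
`|f|` is larger in `D` than on its boundary. If `D` does not meet the circle, the value is `0`. -/
noncomputable def tractMaxModulus (f : ℂ → ℂ) (D : Set ℂ) (ρ : ℝ) : ℝ :=
  sSup ((fun z => ‖f z‖) '' {z : ℂ | ‖z‖ = ρ ∧ z ∈ D})

/-- The open annulus `A(r, R) = {z : r < |z| < R}`. -/
def openAnnulus (r R : ℝ) : Set ℂ := {z | r < ‖z‖ ∧ ‖z‖ < R}

/-- The closed annulus `{z : r ≤ |z| ≤ R}`. -/
def closedAnnulus (r R : ℝ) : Set ℂ := {z | r ≤ ‖z‖ ∧ ‖z‖ ≤ R}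

/-! The universal covering `f : D → {|w| > 1}` identifies `D` with the right half-plane by a
conformal map `φ` satisfying `f ∘ φ = exp`; the inverse of `φ` is a branch of `log f`
(`exists_conformal_of_isUniversalCovering`). The level curve `{|f| = exp t}` is then the image of
the vertical line `Re ζ = t`, and a segment of length `2π` on that line is mapped by `f ∘ φ` onto
the whole circle of radius `exp t`.

Fix `t` with `8π²c / (c - 1) ≤ t ≤ log M_D(r₀)`. Since `0 ∉ D`, the segment from `0` to a point of
`D` of modulus `r₀` at which `|f| = M_D(r₀)` meets the level curve
(`IsDirectTractWith.exists_norm_eq_of_le`). So the curve enters the disc `|z| ≤ r₀`, and it tends to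
infinity in both directions (`IsDirectTractWith.isCompact_setOf_norm_le`). After the last parameter
`y₁` at which it lies in the disc, it stays in `|z| > r₀`, and it remains to see that `|z| < c r₀`
for parameters in `(y₁, y₁ + 2π]`.

For this let `ψ` be a branch of `log φ`. As `exp ∘ ψ` is injective, the image of `ψ` contains no two
points differing by `2πi`, hence no disc of radius larger than `π`. Bloch's theorem with the
constant `1 / 8` (`exists_ball_subset_image_unitBall`) gives `|ψ' ζ| ≤ 4π / Re ζ`, so `log |φ|`
increases by at most `8π² / t ≤ 1 - 1 / c < log c` along the segment. This argument takes the place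
of the Koebe one-quarter theorem; the constant `1 / 8` is just sufficient because the theorem is
applied on the half-plane, where the conformal map from the disc has derivative `2 Re ζ`. -/

open Complex Metric Set Filter Topology

/-! ### Bloch's theorem and the logarithm of an injective function -/

/-- If `f` keeps distance at least `ε` from `f a` on the circle `|z - a| = r`, then it covers the
disc of radius `ε` about `f a`. In contrast to `DiffContOnCl.ball_subset_image_closedBall`, no
factor `1 / 2` is lost. -/
theorem ball_subset_image_ball_of_le_norm_sub {f : ℂ → ℂ} {a : ℂ} {r R ε : ℝ} (hr : 0 < r)
    (hrR : r < R) (hε : 0 < ε) (hf : DifferentiableOn ℂ f (ball a R))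
    (hsph : ∀ z ∈ sphere a r, ε ≤ ‖f z - f a‖) :
    ball (f a) ε ⊆ f '' ball a r := by
  have hsub : closedBall a r ⊆ ball a R := closedBall_subset_ball hrR
  have hopen : IsOpen (f '' ball a r) := by
    rcases (hf.analyticOnNhd isOpen_ball).is_constant_or_isOpen
      (convex_ball a R).isPreconnected with ⟨w, hw⟩ | h
    · have hz : a + r ∈ sphere a r := by simp [abs_of_pos hr]
      have h1 := hsph _ hz
      rw [hw _ (hsub (sphere_subset_closedBall hz)), hw a (mem_ball_self (hr.trans hrR))] at h1
      simp at h1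
      linarith
    · exact h _ (ball_subset_closedBall.trans hsub) isOpen_ball
  refine (convex_ball (f a) ε).isPreconnected.subset_of_closure_inter_subset hopen
    ⟨f a, mem_ball_self hε, a, mem_ball_self hr, rfl⟩ ?_
  rintro w ⟨hw, hwε⟩
  have hcl : IsClosed (f '' closedBall a r) :=
    ((isCompact_closedBall a r).image_of_continuousOn (hf.continuousOn.mono hsub)).isClosed
  obtain ⟨z, hz, rfl⟩ := closure_minimal (image_mono ball_subset_closedBall) hcl hw
  refine ⟨z, ?_, rfl⟩
  rw [mem_closedBall] at hz
  refine mem_ball.2 (lt_of_le_of_ne hz fun h => ?_)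
  have := hsph z h
  rw [mem_ball, dist_eq_norm] at hwε
  linarith

/-- Schwarz–Pick for a function `q` with `|q| ≤ 2` and `q a = 1`, restricted to a concentric disc
of half the radius, where it takes a linear form. -/
theorem norm_sub_one_le_of_norm_le_two {q : ℂ → ℂ} {a z : ℂ} {R : ℝ}
    (hq : DifferentiableOn ℂ q (ball a R)) (hbd : ∀ z ∈ ball a R, ‖q z‖ ≤ 2) (ha : q a = 1)
    (hz : z ∈ closedBall a (R / 2)) (hR : 0 < R) :
    ‖q z - 1‖ ≤ 2 * (‖z - a‖ / R) := by
  have hne : ∀ z ∈ ball a R, 4 - q z ≠ 0 := by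
    intro z hz h
    have h2 := hbd z hz
    rw [← sub_eq_zero.1 h] at h2
    norm_num at h2
  -- the disc automorphism sending `1 / 2` to `0`, applied to `q / 2`
  set ω : ℂ → ℂ := fun z => 2 * (q z - 1) / (4 - q z)
  have hω : DifferentiableOn ℂ ω (ball a R) :=
    ((hq.sub_const 1).const_mul 2).div (hq.const_sub 4) hne
  have hωa : ω a = 0 := by simp [ω, ha]
  have hmaps : MapsTo ω (ball a R) (closedBall (ω a) 1) := by
    intro z hz
    rw [hωa, mem_closedBall_zero_iff, norm_div, div_le_one (norm_pos_iff.2 (hne z hz))]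
    have h2 := hbd z hz
    refine le_of_sq_le_sq ?_ (norm_nonneg _)
    have h3 : ‖q z‖ ^ 2 ≤ 4 := by nlinarith [norm_nonneg (q z)]
    rw [← normSq_eq_norm_sq, normSq_apply] at h3 ⊢
    rw [← normSq_eq_norm_sq, normSq_apply]
    simp
    nlinarith
  have hzR : z ∈ ball a R := closedBall_subset_ball (by linarith) hz
  have h1 := dist_le_div_mul_dist_of_mapsTo_ball hω hmaps hzR
  rw [hωa, dist_zero_right, dist_eq_norm, norm_div, div_le_iff₀ (norm_pos_iff.2 (hne z hzR)),
    norm_mul, one_div_mul_eq_div] at h1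
  have h4 : ‖4 - q z‖ ≤ 3 + ‖q z - 1‖ := by
    calc ‖4 - q z‖ = ‖3 - (q z - 1)‖ := by ring_nf
      _ ≤ _ := (norm_sub_le _ _).trans (by norm_num)
  have hx : ‖z - a‖ / R ≤ 1 / 2 := by
    rw [div_le_iff₀ hR]
    rw [mem_closedBall, dist_eq_norm] at hz
    linarith
  have hx0 : 0 ≤ ‖z - a‖ / R := by positivity
  norm_num at h1
  nlinarith [norm_nonneg (q z - 1)]

/-- A derivative bound growing linearly in the distance from `a` bounds the deviation from the
tangent at `a` quadratically. -/
theorem norm_sub_sub_mul_le_of_norm_deriv_sub_le {G : ℂ → ℂ} {a b : ℂ} {R K : ℝ}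
    (hG : DifferentiableOn ℂ G (ball a R)) (hb : ‖b - a‖ < R)
    (hK : ∀ z, ‖z - a‖ ≤ ‖b - a‖ → ‖deriv G z - deriv G a‖ ≤ K * ‖z - a‖) :
    ‖G b - G a - deriv G a * (b - a)‖ ≤ K * ‖b - a‖ ^ 2 / 2 := by
  set p : ℝ → ℂ := fun s => a + s * (b - a)
  have hp : ∀ s ∈ Icc (0 : ℝ) 1, ‖p s - a‖ = s * ‖b - a‖ := fun s hs => by
    simp [p, abs_of_nonneg hs.1]
  have hpm : ∀ s ∈ Icc (0 : ℝ) 1, ‖p s - a‖ ≤ ‖b - a‖ := fun s hs => by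
    rw [hp s hs]; exact mul_le_of_le_one_left (norm_nonneg _) hs.2
  have hd : ∀ s ∈ Icc (0 : ℝ) 1, HasDerivAt (fun s : ℝ => G (p s) - G a - deriv G a * (p s - a))
      ((deriv G (p s) - deriv G a) * (b - a)) s := fun s hs => by
    have h1 : HasDerivAt G (deriv G (p s)) (p s) :=
      (hG.differentiableAt (isOpen_ball.mem_nhds (by
        rw [mem_ball, dist_eq_norm]; exact (hpm s hs).trans_lt hb))).hasDerivAt
    have h2 : HasDerivAt p (b - a) s := by
      exact (((hasDerivAt_id s).ofReal_comp.mul_const (b - a)).const_add a).congr_deriv (by simp)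
    have h3 := ((h1.comp s h2).sub_const (G a)).sub ((h2.sub_const a).const_mul (deriv G a))
    exact h3.congr_deriv (by ring)
  have h := image_norm_le_of_norm_deriv_right_le_deriv_boundary (a := (0 : ℝ)) (b := 1)
    (B := fun s => K * ‖b - a‖ ^ 2 * (s ^ 2 / 2)) (B' := fun s => K * ‖b - a‖ ^ 2 * s)
    (fun s hs => (hd s hs).continuousAt.continuousWithinAt)
    (fun s hs => (hd s ⟨hs.1, hs.2.le⟩).hasDerivWithinAt) (by simp [p])
    (fun s => ((((hasDerivAt_id s).pow 2).div_const 2).const_mul (K * ‖b - a‖ ^ 2)).congr_deriv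
      (by simp)) (fun s hs => by
      have hs' : s ∈ Icc (0 : ℝ) 1 := ⟨hs.1, hs.2.le⟩
      rw [norm_mul]
      have := mul_le_mul_of_nonneg_right (hK _ (hpm s hs')) (norm_nonneg (b - a))
      rw [hp s hs'] at this
      linarith) (right_mem_Icc.2 zero_le_one)
  simp [p] at h
  linarith

/-- **Bloch's theorem** with the constant `1 / 8`, stated with a loss `ρ < 1` to be let tend to `1`:
the image of the unit disc under `G` contains a disc of radius `ρ |G' 0| / 8`. -/
theorem exists_ball_subset_image_unitBall {G : ℂ → ℂ} (hG : DifferentiableOn ℂ G (ball 0 1))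
    (h0 : deriv G 0 ≠ 0) {ρ : ℝ} (hρ : 0 < ρ) (hρ1 : ρ < 1) :
    ∃ w, ball w (ρ * ‖deriv G 0‖ / 8) ⊆ G '' ball 0 1 := by
  have hG' : DifferentiableOn ℂ (deriv G) (ball 0 1) := hG.deriv isOpen_ball
  have hsub : closedBall (0 : ℂ) ρ ⊆ ball 0 1 := closedBall_subset_ball hρ1
  -- Landau's choice of the centre: a maximum point of `|G'|` weighted by the distance to the circle
  obtain ⟨a, ha, hmax⟩ := (isCompact_closedBall (0 : ℂ) ρ).exists_isMaxOn
    ⟨0, mem_closedBall_self hρ.le⟩ (f := fun z => ‖deriv G z‖ * (ρ - ‖z‖))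
    ((hG'.continuousOn.mono hsub).norm.mul (by fun_prop))
  set m := ρ - ‖a‖
  set A := ‖deriv G a‖
  have hA0 : ρ * ‖deriv G 0‖ ≤ A * m := by
    have := hmax (mem_closedBall_self (x := (0 : ℂ)) hρ.le)
    simp at this
    linarith
  have hpos : 0 < ρ * ‖deriv G 0‖ := mul_pos hρ (norm_pos_iff.2 h0)
  have hm : 0 < m := by
    by_contra! h
    nlinarith [norm_nonneg (deriv G a)]
  have hA : 0 < A := by
    by_contra! h
    nlinarith
  have hda : deriv G a ≠ 0 := norm_pos_iff.1 hA
  have hball : ∀ z ∈ ball a (m / 2), m / 2 < ρ - ‖z‖ := by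
    intro z hz
    rw [mem_ball, dist_eq_norm] at hz
    have := norm_sub_norm_le z a
    simp only [m] at hz ⊢
    linarith
  have hballsub : ball a (m / 2) ⊆ closedBall 0 ρ := fun z hz => by
    rw [mem_closedBall_zero_iff]
    linarith [hball z hz]
  have hGa : DifferentiableOn ℂ G (ball a (m / 2)) := hG.mono (hballsub.trans hsub)
  -- on the disc of half the radius the derivative at most doubles, so Schwarz–Pick applies
  have hq : ∀ z ∈ closedBall a (m / 2 / 2), ‖deriv G z - deriv G a‖ ≤ 4 * A / m * ‖z - a‖ := by
    intro z hz
    have h := norm_sub_one_le_of_norm_le_two (q := fun z => deriv G z / deriv G a) (a := a)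
      (R := m / 2) ((hG'.mono (hballsub.trans hsub)).div_const _) (fun z hz => by
        rw [norm_div, div_le_iff₀ hA]
        have h1 := hmax (hballsub hz)
        have h2 := hball z hz
        simp only [mem_ofPred_eq] at h1
        by_contra! h3
        have : A * m < ‖deriv G z‖ * (ρ - ‖z‖) := by
          calc A * m = 2 * A * (m / 2) := by ring
            _ < ‖deriv G z‖ * (ρ - ‖z‖) := mul_lt_mul'' h3 h2 (by positivity) (by positivity)
        exact absurd h1 (not_le.2 this)) (div_self hda) hz (by positivity)
    have h1 : deriv G z - deriv G a = (deriv G z / deriv G a - 1) * deriv G a := by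
      field_simp
    rw [h1, norm_mul]
    calc _ ≤ 2 * (‖z - a‖ / (m / 2)) * A := by gcongr
      _ = _ := by field_simp; ring
  refine ⟨G a, (ball_subset_ball (div_le_div_of_nonneg_right hA0 (by norm_num))).trans
    ((ball_subset_image_ball_of_le_norm_sub (r := m / 2 / 2) (R := m / 2) (by positivity)
      (by linarith) (by positivity) hGa fun b hb => ?_).trans
      (image_mono ((ball_subset_ball (by linarith)).trans (hballsub.trans hsub))))⟩
  have hb' : ‖b - a‖ = m / 2 / 2 := by rwa [mem_sphere, dist_eq_norm] at hb
  have h1 := norm_sub_sub_mul_le_of_norm_deriv_sub_le hGa (by rw [hb']; linarith)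
    (K := 4 * A / m) fun z hz => hq z (by rw [mem_closedBall, dist_eq_norm]; linarith)
  have h2 : 4 * A / m * ‖b - a‖ ^ 2 / 2 = A * m / 8 := by
    rw [hb']; field_simp; ring
  have h3 : ‖deriv G a * (b - a)‖ = A * m / 4 := by
    rw [norm_mul, hb']; ring
  have h4 := norm_sub_norm_le (deriv G a * (b - a)) (G b - G a)
  rw [norm_sub_rev (deriv G a * (b - a))] at h4
  linarith

/-- A holomorphic `G` on the unit disc with `exp ∘ G` injective satisfies `|G' 0| ≤ 8π`: a disc of
radius larger than `π` in the image would contain two points differing by `2πi`. -/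
theorem norm_deriv_zero_le_of_injOn_exp_comp {G : ℂ → ℂ} (hG : DifferentiableOn ℂ G (ball 0 1))
    (hinj : InjOn (fun z => exp (G z)) (ball 0 1)) : ‖deriv G 0‖ ≤ 8 * Real.pi := by
  have hpi := Real.pi_pos
  by_contra! h
  have hpos : 0 < ‖deriv G 0‖ := by linarith
  obtain ⟨ρ, hρ, hρ1⟩ := exists_between ((div_lt_one hpos).2 h)
  rw [div_lt_iff₀ hpos] at hρ
  have hρ0 : 0 < ρ := by
    by_contra! h'
    nlinarith
  obtain ⟨w, hw⟩ := exists_ball_subset_image_unitBall hG (norm_pos_iff.1 hpos) hρ0 hρ1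
  have hlt : Real.pi < ρ * ‖deriv G 0‖ / 8 := by linarith
  obtain ⟨z₁, hz₁, h₁⟩ := hw (a := w + Real.pi * I) (by simpa [dist_eq_norm, abs_of_pos hpi] using hlt)
  obtain ⟨z₂, hz₂, h₂⟩ := hw (a := w - Real.pi * I) (by simpa [dist_eq_norm, abs_of_pos hpi] using hlt)
  have h12 : z₁ = z₂ := hinj hz₁ hz₂ (by
    simp only [h₁, h₂]
    rw [exp_eq_exp_iff_exists_int]
    exact ⟨1, by push_cast; ring⟩)
  rw [h12, h₂] at h₁
  have := congrArg Complex.im h₁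
  simp at this
  linarith

/-- The bound at the point `ζ` of the right half-plane, by way of the conformal map
`z ↦ Re ζ * (1 + z) / (1 - z) + i Im ζ` of the unit disc, which has derivative `2 Re ζ` at `0`. -/
theorem norm_deriv_le_of_injOn_exp_comp_re_pos {ψ : ℂ → ℂ}
    (hψ : DifferentiableOn ℂ ψ {ζ | 0 < ζ.re}) (hinj : InjOn (fun z => exp (ψ z)) {ζ | 0 < ζ.re})
    {ζ : ℂ} (hζ : 0 < ζ.re) : ‖deriv ψ ζ‖ ≤ 4 * Real.pi / ζ.re := by
  set C : ℂ → ℂ := fun z => ζ.re * ((1 + z) / (1 - z)) + ζ.im * I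
  have hne : ∀ z ∈ ball (0 : ℂ) 1, 1 - z ≠ 0 := by
    intro z hz h
    rw [← sub_eq_zero.1 h] at hz
    simp at hz
  have hC0 : C 0 = ζ := by simp [C, re_add_im]
  have hCd : DifferentiableOn ℂ C (ball 0 1) :=
    (((differentiableOn_id.const_add 1).div (differentiableOn_id.const_sub 1) hne).const_mul
      _).add_const _
  have hCm : MapsTo C (ball 0 1) {ζ | 0 < ζ.re} := by
    intro z hz
    have h1 : 0 < normSq (1 - z) := normSq_pos.2 (hne z hz)
    have h2 : normSq z < 1 := by
      rw [normSq_eq_norm_sq]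
      rw [mem_ball_zero_iff] at hz
      nlinarith [norm_nonneg z]
    have h3 : (C z).re = ζ.re * ((1 - normSq z) / normSq (1 - z)) := by
      simp only [C, add_re, re_ofReal_mul, div_re, normSq_apply]
      simp only [sub_re, sub_im, add_im, one_re, one_im, I_re]
      ring
    simp only [mem_ofPred_eq, h3]
    exact mul_pos hζ (div_pos (by linarith) h1)
  have hCi : InjOn C (ball 0 1) := by
    intro z hz w hw h
    have hz' := hne z hz
    have hw' := hne w hw
    have hζ' : (ζ.re : ℂ) ≠ 0 := by exact_mod_cast hζ.ne'
    have h1 := mul_left_cancel₀ hζ' (add_right_cancel h)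
    rw [div_eq_div_iff hz' hw'] at h1
    linear_combination h1 / 2
  have hCderiv : HasDerivAt C (2 * ζ.re) 0 := by
    have h := ((((hasDerivAt_id (0 : ℂ)).const_add 1).div ((hasDerivAt_id (0 : ℂ)).const_sub 1)
      (by simp)).const_mul (ζ.re : ℂ)).add_const (ζ.im * I)
    exact h.congr_deriv (by simp; ring)
  have hψd : HasDerivAt ψ (deriv ψ ζ) (C 0) := by
    rw [hC0]
    exact (hψ.differentiableAt ((isOpen_lt continuous_const continuous_re).mem_nhds
      hζ)).hasDerivAt
  have h := norm_deriv_zero_le_of_injOn_exp_comp (hψ.comp hCd hCm) (hinj.comp hCi hCm)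
  rw [(hψd.comp 0 hCderiv).deriv] at h
  simp [abs_of_pos hζ] at h
  rw [le_div_iff₀ hζ]
  linarith

/-! ### Uniformization of a logarithmic tract -/

/-- A continuous branch of the logarithm of a holomorphic function is holomorphic. -/
theorem differentiableOn_of_exp_comp {U : Set ℂ} (hU : IsOpen U) {g ψ : ℂ → ℂ}
    (hg : DifferentiableOn ℂ g U) (hψ : ContinuousOn ψ U) (h : ∀ z ∈ U, exp (ψ z) = g z) :
    DifferentiableOn ℂ ψ U := by
  intro z₀ hz₀
  refine DifferentiableAt.differentiableWithinAt ?_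
  have hc : Tendsto (fun z => (ψ z - ψ z₀).im) (𝓝 z₀) (𝓝 0) := by
    have h1 := (continuous_im.continuousAt (x := ψ z₀ - ψ z₀)).tendsto.comp
      ((hψ.continuousAt (hU.mem_nhds hz₀)).tendsto.sub_const (ψ z₀))
    simpa [Function.comp_def] using h1
  -- near `z₀` the function `ψ - ψ z₀` is the principal branch of `log (g / g z₀)`
  have heq : ψ =ᶠ[𝓝 z₀] fun z => ψ z₀ + log (g z / g z₀) := by
    filter_upwards [hU.mem_nhds hz₀,
      hc.eventually (Ioo_mem_nhds (neg_lt_zero.2 Real.pi_pos) Real.pi_pos)] with z hz hzi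
    rw [← h z hz, ← h z₀ hz₀, ← exp_sub, log_exp hzi.1 hzi.2.le]
    ring
  have hg0 : g z₀ ≠ 0 := h z₀ hz₀ ▸ exp_ne_zero _
  refine DifferentiableAt.congr_of_eventuallyEq ?_ heq
  refine (((hg.differentiableAt (hU.mem_nhds hz₀)).div_const _).clog ?_).const_add _
  simp [div_self hg0]

/-- A continuous right inverse of a holomorphic function is holomorphic: the critical points of the
function are isolated, and the singularities they could cause are removable. -/
theorem differentiableOn_of_comp_eq_id {U V : Set ℂ} (hU : IsOpen U) (hV : IsOpen V)
    {L φ : ℂ → ℂ} (hL : DifferentiableOn ℂ L U) (hφ : ContinuousOn φ V) (hm : MapsTo φ V U)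
    (h : ∀ ζ ∈ V, L (φ ζ) = ζ) : DifferentiableOn ℂ φ V := by
  intro ζ₀ hζ₀
  have hcont : ∀ ζ ∈ V, ContinuousAt φ ζ := fun ζ hζ => hφ.continuousAt (hV.mem_nhds hζ)
  have hLd : ∀ z ∈ U, AnalyticAt ℂ L z := fun z hz => hL.analyticAt (hU.mem_nhds hz)
  have hreg : ∀ ζ ∈ V, deriv L (φ ζ) ≠ 0 → DifferentiableAt ℂ φ ζ := fun ζ hζ h0 =>
    (HasDerivAt.of_local_left_inverse (hcont ζ hζ)
      (hLd _ (hm hζ)).differentiableAt.hasDerivAt h0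
      (by filter_upwards [hV.mem_nhds hζ] with x hx using h x hx)).differentiableAt
  refine (analyticAt_of_differentiable_on_punctured_nhds_of_continuousAt ?_
    (hcont ζ₀ hζ₀)).differentiableAt.differentiableWithinAt
  rcases (hLd _ (hm hζ₀)).deriv.eventually_eq_zero_or_eventually_ne_zero with h0 | h0
  · -- `L` would be constant near `φ ζ₀`, although `L ∘ φ = id`
    exfalso
    obtain ⟨r, hr, hball⟩ := Metric.eventually_nhds_iff_ball.1
      (h0.and (hU.mem_nhds (hm hζ₀)))
    have hconst : ∀ z ∈ ball (φ ζ₀) r, L z = L (φ ζ₀) := fun z hz =>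
      (convex_ball (φ ζ₀) r).is_const_of_fderivWithin_eq_zero
        (fun w hw => (hLd w (hball w hw).2).differentiableAt.differentiableWithinAt)
        (fun w hw => by
          rw [fderivWithin_of_isOpen isOpen_ball hw]
          ext
          simpa using (hball w hw).1) hz (mem_ball_self hr)
    have hev : ∀ᶠ ζ in 𝓝 ζ₀, ζ = ζ₀ := by
      filter_upwards [hV.mem_nhds hζ₀, (hcont ζ₀ hζ₀) (ball_mem_nhds _ hr)] with ζ hζ hζr
      rw [← h ζ hζ, ← h ζ₀ hζ₀, h ζ₀ hζ₀]
      exact (hconst _ hζr).trans (h ζ₀ hζ₀)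
    obtain ⟨ζ, hζ, hne⟩ := ((hev.filter_mono nhdsWithin_le_nhds).and
      (self_mem_nhdsWithin (s := ({ζ₀}ᶜ : Set ℂ)))).exists
    exact hne hζ
  · rw [eventually_nhdsWithin_iff] at h0 ⊢
    filter_upwards [hV.mem_nhds hζ₀, (hcont ζ₀ hζ₀).eventually h0] with ζ hζ h1 hne
    refine hreg ζ hζ (h1 fun h2 => hne ?_)
    rw [mem_singleton_iff, ← h ζ hζ, h2, h ζ₀ hζ₀]

/-- A universal covering `f : D → {w | 1 < |w|}` by a plane domain is, up to a conformal map `φ` of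
the right half-plane onto `D`, the exponential function. The inverse `L` of `φ` is a branch of
`log f`. -/
theorem exists_conformal_of_isUniversalCovering {f : ℂ → ℂ} {D : Set ℂ} (hD : IsOpen D)
    (hf : DifferentiableOn ℂ f D) (hm : MapsTo f D {w : ℂ | 1 < ‖w‖})
    (hcov : IsUniversalCovering (hm.restrict f D {w : ℂ | 1 < ‖w‖})) :
    ∃ φ L : ℂ → ℂ, DifferentiableOn ℂ φ {ζ | 0 < ζ.re} ∧ MapsTo φ {ζ | 0 < ζ.re} D ∧
      (∀ ζ : ℂ, 0 < ζ.re → f (φ ζ) = exp ζ) ∧ (∀ ζ : ℂ, 0 < ζ.re → L (φ ζ) = ζ) ∧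
      ContinuousOn L D ∧ ∀ z ∈ D, 0 < (L z).re ∧ φ (L z) = z := by
  obtain ⟨hsc, hcover, -⟩ := hcov
  have hHo : IsOpen {ζ : ℂ | 0 < ζ.re} := isOpen_lt continuous_const continuous_re
  have hHc : Convex ℝ {ζ : ℂ | 0 < ζ.re} := convex_halfSpace_re_gt 0
  obtain ⟨L, hLc, hL⟩ := exists_continuousOn_eqOn_exp_comp (U := D) hsc hD hf.continuousOn (by
    rintro ⟨z, hz, h0⟩
    have := hm hz
    simp [h0] at this
    linarith)
  have hL' : ∀ z ∈ D, exp (L z) = f z := fun z hz => hL hz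
  have hLH : ∀ z ∈ D, 0 < (L z).re := by
    intro z hz
    have h1 := hm hz
    rwa [mem_ofPred_eq, ← hL' z hz, norm_exp, Real.one_lt_exp_iff] at h1
  obtain ⟨e₀⟩ : Nonempty D := (IsSimplyConnected.nonempty (s := D) hsc).to_subtype
  have : ContractibleSpace {ζ : ℂ | 0 < ζ.re} := hHc.contractibleSpace ⟨1, by simp⟩
  have : LocallyPathConnectedSpace {ζ : ℂ | 0 < ζ.re} := hHo.locallyPathConnectedSpace
  let E : C({ζ : ℂ | 0 < ζ.re}, {w : ℂ | 1 < ‖w‖}) :=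
    ⟨fun ζ => ⟨exp ζ, by
      rw [mem_ofPred_eq, norm_exp, Real.one_lt_exp_iff]
      exact ζ.2⟩, by fun_prop⟩
  obtain ⟨Φ, ⟨hΦ0, hΦ⟩, -⟩ := hcover.existsUnique_continuousMap_lifts E
    ⟨L e₀, hLH _ e₀.2⟩ e₀ (Subtype.ext (hL' _ e₀.2).symm)
  have hΦ' : ∀ ζ, f (Φ ζ) = exp ζ := fun ζ => congrArg Subtype.val (congrFun hΦ ζ)
  have hLres : Continuous (fun z : D => L z) := hLc.domRestrict
  have hconn : PreconnectedSpace {ζ : ℂ | 0 < ζ.re} :=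
    isPreconnected_iff_preconnectedSpace.1 hHc.isPreconnected
  -- both composites agree with the identity at a point, and lift the same map
  have hLΦ : (fun ζ : {ζ : ℂ | 0 < ζ.re} => L (Φ ζ)) = Subtype.val :=
    isCoveringMap_exp.eq_of_comp_eq (hLres.comp Φ.continuous) continuous_subtype_val
      (by
        funext ζ
        exact Subtype.ext ((hL' _ (Φ ζ).2).trans (hΦ' ζ))) ⟨L e₀, hLH _ e₀.2⟩ (by simp [hΦ0])
  have hΦL : (fun z : D => Φ ⟨L z, hLH _ z.2⟩) = id :=
    hcover.eq_of_comp_eq (Φ.continuous.comp (hLres.subtype_mk _)) continuous_id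
      (by
        funext z
        exact Subtype.ext ((hΦ' _).trans (hL' _ z.2))) e₀ hΦ0
  classical
  let φ : ℂ → ℂ := fun ζ => if h : 0 < ζ.re then Φ ⟨ζ, h⟩ else 0
  have hφ : ∀ (ζ : ℂ) (h : 0 < ζ.re), φ ζ = Φ ⟨ζ, h⟩ := fun ζ h => dif_pos h
  have hφm : MapsTo φ {ζ | 0 < ζ.re} D := fun ζ hζ => by
    rw [hφ ζ hζ]
    exact (Φ ⟨ζ, hζ⟩).2
  have hφc : ContinuousOn φ {ζ | 0 < ζ.re} := by
    rw [continuousOn_iff_continuous_domRestrict]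
    refine (continuous_subtype_val.comp Φ.continuous).congr fun ζ => (hφ ζ ζ.2).symm
  have hLφ : ∀ ζ : ℂ, 0 < ζ.re → L (φ ζ) = ζ := fun ζ hζ => by
    rw [hφ ζ hζ]
    exact congrFun hLΦ ⟨ζ, hζ⟩
  refine ⟨φ, L, differentiableOn_of_comp_eq_id hD hHo
    (differentiableOn_of_exp_comp hD hf hLc hL') hφc hφm hLφ, hφm, fun ζ hζ => ?_, hLφ, hLc,
    fun z hz => ⟨hLH z hz, ?_⟩⟩
  · rw [hφ ζ hζ]
    exact hΦ' _
  · rw [hφ _ (hLH z hz)]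
    exact congrArg Subtype.val (congrFun hΦL ⟨z, hz⟩)

/-- Growth of `|φ|` along a vertical line, for a conformal map `φ` of the right half-plane into the
punctured plane. -/
theorem norm_le_norm_mul_exp_of_injOn {φ : ℂ → ℂ} (hφ : DifferentiableOn ℂ φ {ζ | 0 < ζ.re})
    (hinj : InjOn φ {ζ | 0 < ζ.re}) (h0 : ∀ ζ : ℂ, 0 < ζ.re → φ ζ ≠ 0) {t y₁ y₂ : ℝ} (ht : 0 < t)
    (hy : y₁ ≤ y₂) :
    ‖φ (t + y₂ * I)‖ ≤ ‖φ (t + y₁ * I)‖ * Real.exp (4 * Real.pi / t * (y₂ - y₁)) := by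
  have hHo : IsOpen {ζ : ℂ | 0 < ζ.re} := isOpen_lt continuous_const continuous_re
  have hHc : Convex ℝ {ζ : ℂ | 0 < ζ.re} := convex_halfSpace_re_gt 0
  have : ContractibleSpace {ζ : ℂ | 0 < ζ.re} := hHc.contractibleSpace ⟨1, by simp⟩
  have hHsc : IsSimplyConnected {ζ : ℂ | 0 < ζ.re} :=
    inferInstanceAs (SimplyConnectedSpace {ζ : ℂ | 0 < ζ.re})
  obtain ⟨ψ, hψc, hψ⟩ := exists_continuousOn_eqOn_exp_comp hHsc hHo hφ.continuousOn (by
    rintro ⟨ζ, hζ, h⟩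
    exact h0 ζ hζ h)
  have hψd := differentiableOn_of_exp_comp hHo hφ hψc hψ
  have hψi : InjOn (fun z => exp (ψ z)) {ζ | 0 < ζ.re} := hinj.congr hψ.symm
  have hre : ∀ y : ℝ, ((t : ℂ) + y * I).re = t := fun y => by simp
  have hmem : ∀ y : ℝ, (t : ℂ) + y * I ∈ {ζ : ℂ | 0 < ζ.re} := fun y => by
    rw [mem_ofPred_eq, hre]; exact ht
  have hd : ∀ y : ℝ, HasDerivAt (fun y : ℝ => ψ (t + y * I)) (deriv ψ (t + y * I) * I) y :=
    fun y => (hψd.differentiableAt (hHo.mem_nhds (hmem y))).hasDerivAt.comp y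
      ((((hasDerivAt_id y).ofReal_comp.mul_const I).const_add (t : ℂ)).congr_deriv (by simp))
  have hbound := norm_image_sub_le_of_norm_deriv_le_segment' (a := y₁) (b := y₂)
    (fun y _ => (hd y).hasDerivWithinAt) (C := 4 * Real.pi / t) (fun y _ => by
      have := norm_deriv_le_of_injOn_exp_comp_re_pos hψd hψi (hmem y)
      rw [hre] at this
      simpa using this) y₂ (right_mem_Icc.2 hy)
  have hn : ∀ y : ℝ, ‖φ (t + y * I)‖ = Real.exp (ψ (t + y * I)).re := fun y => by
    rw [← hψ (hmem y), Function.comp_apply, norm_exp]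
  rw [hn, hn, ← Real.exp_add, Real.exp_le_exp]
  have := (re_le_norm _).trans hbound
  rw [sub_re] at this
  linarith

/-! ### Level curves in a direct tract -/

namespace IsDirectTractWith

variable {f : ℂ → ℂ} {D : Set ℂ} {R : ℝ}

theorem mem_of_mem_closure (hD : IsDirectTractWith f D R) {z : ℂ} (hz : z ∈ closure D)
    (hfz : ‖f z‖ ≠ R) : z ∈ D := by
  by_contra h
  exact hfz (hD.norm_eq z ⟨hz, fun h' => h (interior_subset h')⟩)

theorem isCompact_closure_inter (hD : IsDirectTractWith f D R) {S : Set ℂ} {T : Set ℝ}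
    (hSc : IsCompact S) (hT : IsClosed T) :
    IsCompact {z | z ∈ S ∩ closure D ∧ ‖f z‖ ∈ T} := by
  have h1 : IsCompact (S ∩ closure D) := hSc.inter_right isClosed_closure
  exact h1.of_isClosed_subset
    ((hD.continuousOn.norm.mono inter_subset_right).preimage_isClosed_of_isClosed
      h1.isClosed hT) (fun z hz => hz.1)

/-- The supremum `M_D(r)` is attained when it exceeds the boundary modulus. -/
theorem exists_norm_eq_tractMaxModulus (hD : IsDirectTractWith f D R) {r : ℝ}
    (hM : R < tractMaxModulus f D r) :
    ∃ z ∈ D, ‖z‖ = r ∧ ‖f z‖ = tractMaxModulus f D r := by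
  have hne : {z : ℂ | ‖z‖ = r ∧ z ∈ D}.Nonempty := by
    by_contra h
    rw [not_nonempty_iff_eq_empty] at h
    have := hD.pos
    simp [tractMaxModulus, h] at hM
    linarith
  have hK : IsCompact (sphere (0 : ℂ) r ∩ closure D) :=
    (isCompact_sphere 0 r).inter_right isClosed_closure
  have hsub : {z : ℂ | ‖z‖ = r ∧ z ∈ D} ⊆ sphere (0 : ℂ) r ∩ closure D := fun z hz =>
    ⟨mem_sphere_zero_iff_norm.2 hz.1, subset_closure hz.2⟩
  obtain ⟨z₀, hz₀, hmax⟩ := hK.exists_isMaxOn (hne.mono hsub)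
    (hD.continuousOn.norm.mono inter_subset_right)
  have hle : tractMaxModulus f D r ≤ ‖f z₀‖ := csSup_le (hne.image _) (by
    rintro _ ⟨z, hz, rfl⟩
    exact hmax (hsub hz))
  have hz₀D : z₀ ∈ D := hD.mem_of_mem_closure hz₀.2 (hM.trans_le hle).ne'
  have hz₀r : ‖z₀‖ = r := mem_sphere_zero_iff_norm.1 hz₀.1
  refine ⟨z₀, hz₀D, hz₀r, le_antisymm (le_csSup ⟨‖f z₀‖, ?_⟩ ⟨z₀, ⟨hz₀r, hz₀D⟩, rfl⟩) hle⟩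
  rintro _ ⟨z, hz, rfl⟩
  exact hmax (hsub hz)

/-- If the origin lies outside the tract, then each level between the boundary modulus and `|f z|`
is attained on the segment from the origin to `z`. -/
theorem exists_norm_eq_of_le (hD : IsDirectTractWith f D R) (h0 : (0 : ℂ) ∉ D) {z : ℂ} (hz : z ∈ D)
    {s : ℝ} (hs : R < s) (hsz : s ≤ ‖f z‖) : ∃ p ∈ D, ‖p‖ ≤ ‖z‖ ∧ ‖f p‖ = s := by
  rcases hsz.eq_or_lt with h | hlt
  · exact ⟨z, hz, le_rfl, h.symm⟩
  set U : Set ℂ := D ∩ (fun z => ‖f z‖) ⁻¹' Ioi s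
  have hUo : IsOpen U :=
    (hD.continuousOn.mono subset_closure).norm.isOpen_inter_preimage hD.isOpen isOpen_Ioi
  obtain ⟨p, hpU, hpseg, hpn⟩ : ∃ p ∈ closure U, p ∈ segment ℝ 0 z ∧ p ∉ U := by
    by_contra! h
    exact h0 ((convex_segment (0 : ℂ) z).isPreconnected.subset_of_closure_inter_subset hUo
      ⟨z, right_mem_segment ℝ 0 z, hz, hlt⟩ (fun p hp => h p hp.1 hp.2)
      (left_mem_segment ℝ 0 z)).1
  have hpcl : p ∈ closure D := closure_mono inter_subset_left hpU
  have hge : s ≤ ‖f p‖ := by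
    have hmem := ((hD.continuousOn.norm p hpcl).mono
      (inter_subset_left.trans subset_closure)).mem_closure hpU (t := Ici s)
      (fun w hw => (show s < ‖f w‖ from hw.2).le)
    rwa [isClosed_Ici.closure_eq] at hmem
  have hpD : p ∈ D := hD.mem_of_mem_closure hpcl (hs.trans_le hge).ne'
  refine ⟨p, hpD, ?_, le_antisymm (not_lt.1 fun h => hpn ⟨hpD, h⟩) hge⟩
  rw [segment_eq_image] at hpseg
  obtain ⟨θ, hθ, rfl⟩ := hpseg
  simpa [abs_of_nonneg hθ.1] using mul_le_of_le_one_left (norm_nonneg z) hθ.2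

/-- The level curve `{|f| = exp t}`, parametrized by `φ` on the line `Re ζ = t`, tends to infinity
in both directions: by continuity of `L` on the compact part of the level set in a disc, only
a bounded set of parameters is mapped into that disc. -/
theorem isCompact_setOf_norm_le (hD : IsDirectTractWith f D R) {φ L : ℂ → ℂ} {t r : ℝ}
    (hφ : Continuous fun y : ℝ => φ (t + y * I)) (hφD : ∀ y : ℝ, φ (t + y * I) ∈ D)
    (hfφ : ∀ y : ℝ, f (φ (t + y * I)) = exp (t + y * I))
    (hLφ : ∀ y : ℝ, L (φ (t + y * I)) = t + y * I) (hL : ContinuousOn L D)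
    (ht : R < Real.exp t) : IsCompact {y : ℝ | ‖φ (t + y * I)‖ ≤ r} := by
  have hK := hD.isCompact_closure_inter (isCompact_closedBall (0 : ℂ) r)
    (isClosed_singleton (x := Real.exp t))
  set K := {z | z ∈ closedBall (0 : ℂ) r ∩ closure D ∧ ‖f z‖ ∈ ({Real.exp t} : Set ℝ)}
  have hKD : K ⊆ D := fun z hz => hD.mem_of_mem_closure hz.1.2 (by
    rw [mem_singleton_iff.1 hz.2]; exact ht.ne')
  refine ((hK.image_of_continuousOn (hL.mono hKD)).image continuous_im).of_isClosed_subset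
    (isClosed_le hφ.norm continuous_const) ?_
  intro y hy
  refine ⟨t + y * I, ⟨φ (t + y * I), ⟨⟨mem_closedBall_zero_iff.2 hy, subset_closure (hφD y)⟩, ?_⟩,
    hLφ y⟩, by simp⟩
  rw [mem_singleton_iff, hfφ, norm_exp]
  simp

end IsDirectTractWith

/-! ### The image of the part of the tract in an annulus -/

theorem lemma3p2 (f : ℂ → ℂ) (D : Set ℂ) (hD : IsLogarithmicTract f D)
    (hfD : f '' D = {w : ℂ | 1 < ‖w‖}) (hf0 : ‖f 0‖ < 1)
    (c r₀ : ℝ) (hc : 1 < c)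
    (hM : Real.exp (8 * Real.pi ^ 2 * c / (c - 1)) < tractMaxModulus f D r₀) :
    closedAnnulus (Real.exp (8 * Real.pi ^ 2 * c / (c - 1))) (tractMaxModulus f D r₀) ⊆
      f '' (openAnnulus r₀ (c * r₀) ∩ D) := by
  have hpi := Real.pi_pos
  obtain ⟨R, hT, hcov⟩ := hD
  -- both `f '' D = {|w| > R}` and `f '' D = {|w| > 1}`: test membership of `(1 + R) / 2`
  obtain rfl : R = 1 := by
    have hR := hT.pos
    have himg : f '' D = {w : ℂ | R < ‖w‖} := by
      ext w
      refine ⟨?_, fun hw => ?_⟩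
      · rintro ⟨z, hz, rfl⟩
        exact hT.lt_norm z hz
      · obtain ⟨z, hz⟩ := hcov.2.2 ⟨w, hw⟩
        exact ⟨z, z.2, congrArg Subtype.val hz⟩
    have hw : ‖(((1 + R) / 2 : ℝ) : ℂ)‖ = (1 + R) / 2 := by
      rw [norm_real, Real.norm_of_nonneg (by linarith)]
    have h1 : R < (1 + R) / 2 ↔ 1 < (1 + R) / 2 := by
      have := Set.ext_iff.1 (himg.symm.trans hfD) (((1 + R) / 2 : ℝ) : ℂ)
      rwa [mem_ofPred_eq, mem_ofPred_eq, hw] at this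
    by_contra hne
    rcases lt_or_gt_of_ne hne with h | h
    · linarith [h1.1 (by linarith)]
    · linarith [h1.2 (by linarith)]
  have h0D : (0 : ℂ) ∉ D := fun h => by linarith [hT.lt_norm 0 h]
  obtain ⟨φ, L, hφd, hφD, hfφ, hLφ, hLc, hφL⟩ :=
    exists_conformal_of_isUniversalCovering hT.isOpen hT.differentiableOn hT.lt_norm hcov
  have hφi : InjOn φ {ζ | 0 < ζ.re} := fun ζ hζ ξ hξ h => by
    rw [← hLφ ζ hζ, ← hLφ ξ hξ, h]
  have hφ0 : ∀ ζ : ℂ, 0 < ζ.re → φ ζ ≠ 0 := fun ζ hζ h => h0D (h ▸ hφD hζ)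
  rintro w ⟨hw1, hw2⟩
  set T : ℝ := 8 * Real.pi ^ 2 * c / (c - 1)
  have hT0 : 0 < T := div_pos (by positivity) (by linarith)
  have hwpos : 0 < ‖w‖ := (Real.exp_pos T).trans_le hw1
  set t : ℝ := Real.log ‖w‖
  have hexp : Real.exp t = ‖w‖ := Real.exp_log hwpos
  have hTt : T ≤ t := by rwa [← Real.exp_le_exp, hexp]
  have ht : 0 < t := hT0.trans_le hTt
  have h1w : 1 < Real.exp t := Real.one_lt_exp_iff.2 ht
  have hmem : ∀ y : ℝ, 0 < ((t : ℂ) + y * I).re := fun y => by simpa using ht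
  have hline : Continuous fun y : ℝ => φ (t + y * I) :=
    hφd.continuousOn.comp_continuous (by fun_prop) hmem
  -- the level curve of `w` meets the closed disc `|z| ≤ r₀`
  obtain ⟨z₀, hz₀D, hz₀r, hz₀M⟩ := hT.exists_norm_eq_tractMaxModulus
    ((Real.one_lt_exp_iff.2 hT0).trans hM)
  obtain ⟨p, hpD, hpr, hpw⟩ := hT.exists_norm_eq_of_le h0D hz₀D h1w
    (by rw [hexp, hz₀M]; exact hw2)
  have hr₀ : 0 < r₀ := by
    rw [← hz₀r, norm_pos_iff]
    rintro rfl
    exact h0D hz₀D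
  set S : Set ℝ := {y : ℝ | ‖φ (t + y * I)‖ ≤ r₀}
  obtain ⟨hpre, hφp⟩ := hφL p hpD
  have hpL : t + (L p).im * I = L p := by
    have h := congrArg norm (hfφ (L p) hpre)
    rw [hφp, hpw, norm_exp, Real.exp_eq_exp] at h
    rw [h, re_add_im]
  have hS : S.Nonempty := by
    refine ⟨(L p).im, ?_⟩
    simp only [S, mem_ofPred_eq]
    rw [hpL, hφp, ← hz₀r]
    exact hpr
  -- the last parameter at which the curve lies in that disc
  obtain ⟨y₁, hy₁, hmax⟩ := (hT.isCompact_setOf_norm_le (r := r₀) hline (fun y => hφD (hmem y))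
    (fun y => hfφ _ (hmem y)) (fun y => hLφ _ (hmem y)) hLc h1w).exists_isGreatest hS
  obtain ⟨y, ⟨hy1, hy2⟩, hyw⟩ : ∃ y ∈ Ioc y₁ (y₁ + 2 * Real.pi), exp (t + y * I) = w := by
    refine ⟨_, toIocMod_mem_Ioc Real.two_pi_pos y₁ (arg w), ?_⟩
    rw [← self_sub_toIocDiv_zsmul]
    refine (exp_eq_exp_iff_exists_int.2 ⟨-toIocDiv Real.two_pi_pos y₁ (arg w), ?_⟩).trans
      (exp_log (norm_pos_iff.1 hwpos))
    rw [Complex.log]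
    push_cast [zsmul_eq_mul]
    ring
  refine ⟨φ (t + y * I), ⟨⟨?_, ?_⟩, hφD (hmem y)⟩, by rw [hfφ _ (hmem y), hyw]⟩
  · by_contra! h
    linarith [hmax h]
  · have hlog : 4 * Real.pi / t * (y - y₁) < Real.log c := by
      calc 4 * Real.pi / t * (y - y₁) ≤ 4 * Real.pi / T * (2 * Real.pi) := by
            gcongr
            linarith
        _ = 1 - c⁻¹ := by
            have : c - 1 ≠ 0 := by linarith
            have : c ≠ 0 := by linarith
            simp only [T]
            field_simp
            ring
        _ < Real.log c := by
            have := Real.log_lt_sub_one_of_pos (inv_pos.2 (zero_lt_one.trans hc))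
              (inv_lt_one_of_one_lt₀ hc).ne
            rw [Real.log_inv] at this
            linarith
    calc ‖φ (t + y * I)‖ ≤ ‖φ (t + y₁ * I)‖ * Real.exp (4 * Real.pi / t * (y - y₁)) :=
          norm_le_norm_mul_exp_of_injOn hφd hφi hφ0 ht hy1.le
      _ ≤ r₀ * Real.exp (4 * Real.pi / t * (y - y₁)) := by
          gcongr
          exact hy₁
      _ < r₀ * Real.exp (Real.log c) := by gcongr
      _ = c * r₀ := by rw [Real.exp_log (by linarith), mul_comm]
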